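/- Let $Y$ be a real random variable and $X$ a random vector of $\mathbb{R}^p$ with $\mathbb{E}\|X\|^2<\infty$ and invertible covariance matrix $\Sigma$, and put $Z=\Sigma^{-1/2}(X-\mathbb{E}[X])$. A subspace $F$ of $\mathbb{R}^p$, with orthogonal projection $P_F$, is a dimension reduction subspace if $\mathbb{P}(Y\in A\mid X)=\mathbb{P}(Y\in A\mid P_FX)$ a.s. for every Borel set $A$. Assume that there is a unique dimension reduction subspace $F_c$ of minimal dimension (the central subspace), put $E_c=\Sigma^{1/2}F_c$ and $d=\dim E_c$, let $P_c$ be the orthogonal projection onto $E_c$ and $Q_c=I-P_c$, and assume the linearity condition $Q_c\,\mathbb{E}[Z\mid P_cZ]=0$ a.s. Let $I(1),\dots,I(H)$ be pairwise disjoint Borel subsets of $\mathbb{R}$ (slices of the range of $Y$), let $C=(C_1,\dots,C_H)$ with $C_h=\mathbb{E}[Z\mathbf{1}_{\{Y\in I(h)\}}]$, and let $D=\mathrm{diag}(d_1,\dots,d_H)$ with $d_h=\mathbb{E}[\|Q_cZ\|^2\mathbf{1}_{\{Y\in I(h)\}}]$. Assume that $d_h>0$ for every $h$ and that the slicing is fine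 enough for the vectors $C_1,\dots,C_H$ to cover $E_c$, i.e. $E_c\subset\mathrm{span}(C_1,\dots,C_H)$. For $\alpha=(\alpha_{h,k})\in\mathbb{R}^{H\times d}$ put $\psi_k(y)=\sum_{h=1}^H\alpha_{h,k}\mathbf{1}_{\{y\in I(h)\}}$, $\eta_k=\mathbb{E}[Z\psi_k(Y)]$ and $\eta=(\eta_1,\dots,\eta_d)\in\mathbb{R}^{p\times d}$. Let $(X_i,Y_i)_{i\ge1}$ be i.i.d. copies of $(X,Y)$, let $Z_i=\Sigma^{-1/2}(X_i-\mathbb{E}[X])$ and $\widehat\eta_k=\frac1n\sum_{i=1}^nZ_i\psi_k(Y_i)$, and let $\widehat P_n$ be the orthogonal projection onto $\mathrm{span}(\widehat\eta_1,\dots,\widehat\eta_d)$. Then, for every $\alpha$ such that $\eta_1,\dots,\eta_d$ are linearly independent, $n\,\mathrm{tr}(Q_c\widehat P_n)$ converges in law, as $n\to\infty$, to a random variable $W_\alpha$ with finite expectation. Moreover, the matrix $G=D^{-1/2}C^TCD^{-1/2}$ has rank $d$, so that there are an orthogonal matrix $P=(P_1\ P_2)\in\mathbb{R}^{H\times(d+(H-d))}$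 and a diagonal matrix $D_0\in\mathbb{R}^{d\times d}$ with $$P^TGP=\begin{pmatrix}D_0&0\\0&0\end{pmatrix}.$$ For any such $P$ and $D_0$, the diagonal entries of $D_0$ are positive, and the solutions $\alpha\in\mathbb{R}^{H\times d}$ of the minimization problem $$\min_\alpha\ \mathbb{E}[W_\alpha]\quad\text{subject to}\quad\eta^T\eta=I$$ are exactly the matrices $$\alpha=D^{-1/2}P_1D_0^{-1/2}O,\qquad O\in\mathbb{R}^{d\times d}\ \text{orthogonal}.$$ -/

import Mathlib

open MeasureTheory ProbabilityTheory Filter Matrix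
open scoped Topology MatrixOrder

namespace TestFunction

noncomputable section

/-! ### Dimension reduction subspaces and the central subspace -/

/-- `F` is a dimension reduction subspace for the regression of `Y` on `X`: for every measurable
set `A`, `P(Y ∈ A | X) = P(Y ∈ A | P_F X)` almost surely, where `P_F` is the orthogonal projection
onto `F` (that is, `Y` and `X` are conditionally independent given `P_F X`). -/
def IsDRS {Ω : Type*} [MeasurableSpace Ω] (μ : Measure Ω) {p : ℕ}
    (X : Ω → EuclideanSpace ℝ (Fin p)) (Y : Ω → ℝ)
    (F : Submodule ℝ (EuclideanSpace ℝ (Fin p))) : Prop :=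
  ∀ A : Set ℝ, MeasurableSet A →
    μ[(Y ⁻¹' A).indicator (fun _ => (1 : ℝ)) | MeasurableSpace.comap X inferInstance]
      =ᵐ[μ]
    μ[(Y ⁻¹' A).indicator (fun _ => (1 : ℝ)) |
      MeasurableSpace.comap (fun ω => F.starProjection (X ω)) inferInstance]

/-- `F` is the central subspace: the unique dimension reduction subspace of minimal dimension. -/
def IsCentralSubspace {Ω : Type*} [MeasurableSpace Ω] (μ : Measure Ω) {p : ℕ}
    (X : Ω → EuclideanSpace ℝ (Fin p)) (Y : Ω → ℝ)
    (F : Submodule ℝ (EuclideanSpace ℝ (Fin p))) : Prop :=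
  IsDRS μ X Y F ∧
    ∀ F' : Submodule ℝ (EuclideanSpace ℝ (Fin p)), IsDRS μ X Y F' → F' ≠ F →
      Module.finrank ℝ F < Module.finrank ℝ F'

/-! ### Standardization -/

/-- The covariance matrix `Σ = var(X)`. -/
def covMat {Ω : Type*} [MeasurableSpace Ω] (μ : Measure Ω) {p : ℕ}
    (X : Ω → EuclideanSpace ℝ (Fin p)) : Matrix (Fin p) (Fin p) ℝ :=
  Matrix.of fun i j => covariance (fun ω => X ω i) (fun ω => X ω j) μ

/-- The standardizing map `x ↦ Σ^{-1/2} (x - E[X])`. -/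
def standardize {Ω : Type*} [MeasurableSpace Ω] (μ : Measure Ω) {p : ℕ}
    (X : Ω → EuclideanSpace ℝ (Fin p)) (x : EuclideanSpace ℝ (Fin p)) :
    EuclideanSpace ℝ (Fin p) :=
  Matrix.toEuclideanLin (CFC.sqrt (covMat μ X))⁻¹ (x - ∫ ω, X ω ∂μ)

/-- `E` is the standardized central subspace `Σ^{1/2} F`, where `F` is the central subspace. -/
def IsStandardizedCentralSubspace {Ω : Type*} [MeasurableSpace Ω] (μ : Measure Ω) {p : ℕ}
    (X : Ω → EuclideanSpace ℝ (Fin p)) (Y : Ω → ℝ)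
    (E : Submodule ℝ (EuclideanSpace ℝ (Fin p))) : Prop :=
  ∃ F : Submodule ℝ (EuclideanSpace ℝ (Fin p)), IsCentralSubspace μ X Y F ∧
    E = F.map (Matrix.toEuclideanLin (CFC.sqrt (covMat μ X)))

/-- The projection `Q = I - P_E`. -/
def complProj {p : ℕ} (E : Submodule ℝ (EuclideanSpace ℝ (Fin p))) :
    EuclideanSpace ℝ (Fin p) →L[ℝ] EuclideanSpace ℝ (Fin p) :=
  ContinuousLinearMap.id ℝ _ - E.starProjection

/-- The linearity condition `Q E[Z | P_E Z] = 0` a.s., with `Q = I - P_E`. -/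
def LinearityCondition {Ω : Type*} [MeasurableSpace Ω] (μ : Measure Ω) {p : ℕ}
    (Z : Ω → EuclideanSpace ℝ (Fin p)) (E : Submodule ℝ (EuclideanSpace ℝ (Fin p))) : Prop :=
  ∀ᵐ ω ∂μ, complProj E
    ((μ[Z | MeasurableSpace.comap (fun ω => E.starProjection (Z ω)) inferInstance]) ω) = 0

/-! ### Order 1 test functions built from slice indicators -/

/-- The test function `ψ_k(y) = ∑ h, α_{h,k} 1_{y ∈ I(h)}`. -/
def testFun {H d : ℕ} (I : Fin H → Set ℝ) (α : Matrix (Fin H) (Fin d) ℝ) (k : Fin d) (y : ℝ) : ℝ :=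
  ∑ h, α h k * (I h).indicator (fun _ => (1 : ℝ)) y

/-- The population vector `η_k = E[Z ψ_k(Y)]`. -/
def eta {Ω : Type*} [MeasurableSpace Ω] (μ : Measure Ω) {p H d : ℕ}
    (Z : Ω → EuclideanSpace ℝ (Fin p)) (Y : Ω → ℝ) (I : Fin H → Set ℝ)
    (α : Matrix (Fin H) (Fin d) ℝ) (k : Fin d) : EuclideanSpace ℝ (Fin p) :=
  ∫ ω, testFun I α k (Y ω) • Z ω ∂μ

/-- The `p × d` matrix `η = (η_1, …, η_d)`. -/
def etaMat {Ω : Type*} [MeasurableSpace Ω] (μ : Measure Ω) {p H d : ℕ}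
    (Z : Ω → EuclideanSpace ℝ (Fin p)) (Y : Ω → ℝ) (I : Fin H → Set ℝ)
    (α : Matrix (Fin H) (Fin d) ℝ) : Matrix (Fin p) (Fin d) ℝ :=
  Matrix.of fun i k => eta μ Z Y I α k i

/-- The empirical vector `η̂_k = n⁻¹ ∑_{i < n} Z_i ψ_k(Y_i)` of a sample `(z, y)`. -/
def etaHat {p H d : ℕ} (z : ℕ → EuclideanSpace ℝ (Fin p)) (y : ℕ → ℝ) (I : Fin H → Set ℝ)
    (α : Matrix (Fin H) (Fin d) ℝ) (n : ℕ) (k : Fin d) : EuclideanSpace ℝ (Fin p) :=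
  (n : ℝ)⁻¹ • ∑ i ∈ Finset.range n, testFun I α k (y i) • z i

/-- `P̂_n`: the orthogonal projection onto the span of `η̂_1, …, η̂_d`. -/
def projHat {p H d : ℕ} (z : ℕ → EuclideanSpace ℝ (Fin p)) (y : ℕ → ℝ) (I : Fin H → Set ℝ)
    (α : Matrix (Fin H) (Fin d) ℝ) (n : ℕ) :
    EuclideanSpace ℝ (Fin p) →L[ℝ] EuclideanSpace ℝ (Fin p) :=
  (Submodule.span ℝ (Set.range (etaHat z y I α n))).starProjection

/-- The statistic `n tr(Q P̂_n)`, with `Q = I - P_E`. -/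
def traceStat {p H d : ℕ} (E : Submodule ℝ (EuclideanSpace ℝ (Fin p)))
    (z : ℕ → EuclideanSpace ℝ (Fin p)) (y : ℕ → ℝ) (I : Fin H → Set ℝ)
    (α : Matrix (Fin H) (Fin d) ℝ) (n : ℕ) : ℝ :=
  n * LinearMap.trace ℝ (EuclideanSpace ℝ (Fin p))
    ((complProj E).toLinearMap ∘ₗ (projHat z y I α n).toLinearMap)

/-! ### The matrices `C`, `D`, `G` -/

/-- `C_h = E[Z 1_{Y ∈ I(h)}]`. -/
def sliceVec {Ω : Type*} [MeasurableSpace Ω] (μ : Measure Ω) {p H : ℕ}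
    (Z : Ω → EuclideanSpace ℝ (Fin p)) (Y : Ω → ℝ) (I : Fin H → Set ℝ) (h : Fin H) :
    EuclideanSpace ℝ (Fin p) :=
  ∫ ω, (I h).indicator (fun _ => (1 : ℝ)) (Y ω) • Z ω ∂μ

/-- The `p × H` matrix `C = (C_1, …, C_H)`. -/
def sliceMat {Ω : Type*} [MeasurableSpace Ω] (μ : Measure Ω) {p H : ℕ}
    (Z : Ω → EuclideanSpace ℝ (Fin p)) (Y : Ω → ℝ) (I : Fin H → Set ℝ) :
    Matrix (Fin p) (Fin H) ℝ :=
  Matrix.of fun i h => sliceVec μ Z Y I h i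

/-- `d_h = E[‖Q Z‖² 1_{Y ∈ I(h)}]`, with `Q = I - P_E`. -/
def sliceVar {Ω : Type*} [MeasurableSpace Ω] (μ : Measure Ω) {p H : ℕ}
    (E : Submodule ℝ (EuclideanSpace ℝ (Fin p)))
    (Z : Ω → EuclideanSpace ℝ (Fin p)) (Y : Ω → ℝ) (I : Fin H → Set ℝ) (h : Fin H) : ℝ :=
  ∫ ω, ‖complProj E (Z ω)‖ ^ 2 * (I h).indicator (fun _ => (1 : ℝ)) (Y ω) ∂μ

/-- `diag(v)^{-1/2}`, for a vector `v` with positive entries. -/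
def diagInvSqrt {m : ℕ} (v : Fin m → ℝ) : Matrix (Fin m) (Fin m) ℝ :=
  Matrix.diagonal fun i => (√(v i))⁻¹

/-- `G = D^{-1/2} Cᵀ C D^{-1/2}`. -/
def gramMat {Ω : Type*} [MeasurableSpace Ω] (μ : Measure Ω) {p H : ℕ}
    (E : Submodule ℝ (EuclideanSpace ℝ (Fin p)))
    (Z : Ω → EuclideanSpace ℝ (Fin p)) (Y : Ω → ℝ) (I : Fin H → Set ℝ) :
    Matrix (Fin H) (Fin H) ℝ :=
  diagInvSqrt (sliceVar μ E Z Y I) * (sliceMat μ Z Y I)ᵀ * sliceMat μ Z Y I *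
    diagInvSqrt (sliceVar μ E Z Y I)

/-- `P = (P₁ P₂)` is an orthogonal `H × H` matrix, with `P₁` of size `H × d`, and
`Pᵀ G P = diag(D₀, 0)` with `D₀` a diagonal `d × d` matrix (given by its diagonal). -/
def Diagonalizes {H d : ℕ} (G : Matrix (Fin H) (Fin H) ℝ)
    (P₁ : Matrix (Fin H) (Fin d) ℝ) (P₂ : Matrix (Fin H) (Fin (H - d)) ℝ) (D₀ : Fin d → ℝ) : Prop :=
  (fromCols P₁ P₂)ᵀ * fromCols P₁ P₂ = 1 ∧
  fromCols P₁ P₂ * (fromCols P₁ P₂)ᵀ = 1 ∧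
  (fromCols P₁ P₂)ᵀ * G * fromCols P₁ P₂ = fromBlocks (Matrix.diagonal D₀) 0 0 0

/-- `α` minimizes `E[W_α]` (the mean of the law `W α`) subject to `ηᵀ η = I`. -/
def IsOptimal {Ω : Type*} [MeasurableSpace Ω] (μ : Measure Ω) {p H d : ℕ}
    (Z : Ω → EuclideanSpace ℝ (Fin p)) (Y : Ω → ℝ) (I : Fin H → Set ℝ)
    (W : Matrix (Fin H) (Fin d) ℝ → ProbabilityMeasure ℝ) (α : Matrix (Fin H) (Fin d) ℝ) : Prop :=
  (etaMat μ Z Y I α)ᵀ * etaMat μ Z Y I α = 1 ∧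
  ∀ β : Matrix (Fin H) (Fin d) ℝ, (etaMat μ Z Y I β)ᵀ * etaMat μ Z Y I β = 1 →
    ∫ x, x ∂(W α : Measure ℝ) ≤ ∫ x, x ∂(W β : Measure ℝ)

end

end TestFunction

/-! Sufficiency of the central subspace and the linearity condition force every `C_h` into `E`
(`integral_indicator_smul_mem`), so by the covering assumption the `C_h` span exactly `E`, `C` and
`G` have rank `d`, and `Q η_k = 0`.

For independent `v_k`, `tr(Q P_span(v))` is a quadratic form in the `Q v_k`, weighted by the inverse
Gram matrix of `v`. At the empirical means, `√n Q η̂` is asymptotically centered Gaussian and the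
weights converge almost surely, so Slutsky gives the limit `W_α = ∑ (ηᵀη)⁻¹_{kl} ⟪N_k, N_l⟫`
(`tendstoInDistribution_trace`); the projection itself need not be differentiated.

The mean of `W_α` involves second moments only. When `ηᵀη = I`, disjointness of the slices makes it
`tr(αᵀ D α)`, and `η = Cα`. With `γ = D^{1/2} α`, the constraint says that `D₀^{1/2} P₁ᵀ γ` is
orthogonal, which fixes `tr((P₁ᵀγ)ᵀ(P₁ᵀγ)) = tr(D₀⁻¹)`. The objective is this constant plus the
squared norm of `P₂ᵀ γ`, so the minimizers are the feasible points with `P₂ᵀ γ = 0`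
(`isMinimizer_iff`). -/

namespace TestFunction

/-! ### Orthogonal projections and the trace statistic. -/

section Projection

variable {p : ℕ}

lemma complProj_apply (E : Submodule ℝ (EuclideanSpace ℝ (Fin p)))
    (x : EuclideanSpace ℝ (Fin p)) : complProj E x = x - E.starProjection x := by
  simp [complProj]

lemma complProj_mem_orthogonal (E : Submodule ℝ (EuclideanSpace ℝ (Fin p)))
    (x : EuclideanSpace ℝ (Fin p)) : complProj E x ∈ Eᗮ := by
  rw [complProj_apply]
  exact E.sub_starProjection_mem_orthogonal x

lemma complProj_eq_zero_iff (E : Submodule ℝ (EuclideanSpace ℝ (Fin p)))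
    {x : EuclideanSpace ℝ (Fin p)} : complProj E x = 0 ↔ x ∈ E := by
  rw [complProj_apply, sub_eq_zero, eq_comm, Submodule.starProjection_eq_self_iff]

lemma inner_complProj_complProj (E : Submodule ℝ (EuclideanSpace ℝ (Fin p)))
    (x y : EuclideanSpace ℝ (Fin p)) :
    inner ℝ (complProj E x) (complProj E y) = inner ℝ (complProj E x) y := by
  rw [complProj_apply E y, inner_sub_right, sub_eq_self, real_inner_comm]
  exact complProj_mem_orthogonal E x _ (E.starProjection_apply_mem y)

lemma inner_complProj_comm (E : Submodule ℝ (EuclideanSpace ℝ (Fin p)))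
    (x y : EuclideanSpace ℝ (Fin p)) :
    inner ℝ (complProj E x) y = inner ℝ x (complProj E y) := by
  rw [← inner_complProj_complProj, real_inner_comm, inner_complProj_complProj, real_inner_comm]

lemma complProj_complProj (E : Submodule ℝ (EuclideanSpace ℝ (Fin p)))
    (x : EuclideanSpace ℝ (Fin p)) : complProj E (complProj E x) = complProj E x := by
  refine ext_inner_right ℝ fun y => ?_
  rw [inner_complProj_comm, inner_complProj_complProj]

/-- The orthogonal projection onto the span of linearly independent vectors, through the inverse of
their Gram matrix. -/
lemma starProjection_span_range_apply {ι F : Type*} [Fintype ι] [DecidableEq ι]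
    [NormedAddCommGroup F] [InnerProductSpace ℝ F] [FiniteDimensional ℝ F] {v : ι → F}
    (hv : LinearIndependent ℝ v) (x : F) :
    (Submodule.span ℝ (Set.range v)).starProjection x
      = ∑ k, (∑ l, (gram ℝ v)⁻¹ k l * inner ℝ (v l) x) • v k := by
  have hdet : IsUnit (gram ℝ v).det :=
    isUnit_iff_ne_zero.2 (det_gram_ne_zero_iff_linearIndependent.2 hv)
  refine Submodule.eq_starProjection_of_mem_of_inner_eq_zero
    (K := Submodule.span ℝ (Set.range v)) ?_ ?_
  · exact Submodule.sum_mem _ fun k _ =>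
      Submodule.smul_mem _ _ (Submodule.subset_span (Set.mem_range_self k))
  · intro w hw
    induction hw using Submodule.span_induction with
    | mem w hw =>
      obtain ⟨m, rfl⟩ := hw
      -- The normal equations: the chosen coefficients give the residual zero inner product with
      -- each `v m`.
      have key : (gram ℝ v *ᵥ ((gram ℝ v)⁻¹ *ᵥ fun l => inner ℝ (v l) x)) m
          = inner ℝ (v m) x := by
        rw [mulVec_mulVec, mul_nonsing_inv _ hdet, one_mulVec]
      rw [real_inner_comm, inner_sub_right, inner_sum, sub_eq_zero, ← key]
      simp [mulVec, dotProduct, gram_apply, inner_smul_right, mul_comm]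
    | zero => simp
    | add a b _ _ ha hb => rw [inner_add_right, ha, hb, add_zero]
    | smul c a _ ha => rw [inner_smul_right, ha, mul_zero]

/-- The quadratic form `x ↦ ∑ k l, m k l ⟪x_k, x_l⟫` of the columns of `x`. -/
noncomputable def quadSum {d : ℕ} (x : EuclideanSpace ℝ (Fin p × Fin d))
    (m : Fin d → Fin d → ℝ) : ℝ :=
  ∑ k, ∑ l, m k l * ∑ a, x (a, k) * x (a, l)

/-- The map is a sum of rank-one maps `x ↦ ⟪v_l, x⟫ Q v_k`, whose traces are `⟪Q v_k, Q v_l⟫` since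
`Q` is a symmetric idempotent. Being quadratic in `Q v`, which vanishes in the limit, the trace has
the scale `1/n`. -/
lemma trace_complProj_comp_starProjection {d : ℕ} (E : Submodule ℝ (EuclideanSpace ℝ (Fin p)))
    {v : Fin d → EuclideanSpace ℝ (Fin p)} (hv : LinearIndependent ℝ v) :
    LinearMap.trace ℝ (EuclideanSpace ℝ (Fin p)) ((complProj E).toLinearMap ∘ₗ
        ((Submodule.span ℝ (Set.range v)).starProjection).toLinearMap)
      = ∑ k, ∑ l, (gram ℝ v)⁻¹ k l * inner ℝ (complProj E (v k)) (complProj E (v l)) := by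
  have h : (complProj E).toLinearMap ∘ₗ
        ((Submodule.span ℝ (Set.range v)).starProjection).toLinearMap
      = ∑ k, ∑ l, (gram ℝ v)⁻¹ k l •
          (innerSL ℝ (v l)).toLinearMap.smulRight (complProj E (v k)) := by
    ext1 x
    simp only [LinearMap.comp_apply, ContinuousLinearMap.coe_coe, LinearMap.sum_apply,
      LinearMap.smul_apply, LinearMap.smulRight_apply, innerSL_apply_apply]
    rw [starProjection_span_range_apply hv, map_sum]
    simp only [Finset.sum_smul, mul_smul, map_sum, map_smul]
  rw [h, map_sum]
  refine Finset.sum_congr rfl fun k _ => ?_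
  rw [map_sum]
  refine Finset.sum_congr rfl fun l _ => ?_
  rw [map_smul, LinearMap.trace_smulRight, smul_eq_mul, inner_complProj_complProj, real_inner_comm]
  rfl

/-- Since `Q² = Q`, cyclicity gives `tr(QP) = tr(QPQ)`, and Pythagoras turns each `⟪y, P y⟫` into a
difference of squared distances. No independence is involved, so the formula serves to prove
measurability on all families. -/
lemma trace_complProj_comp_starProjection_eq_sum (E V : Submodule ℝ (EuclideanSpace ℝ (Fin p))) :
    LinearMap.trace ℝ (EuclideanSpace ℝ (Fin p))
        ((complProj E).toLinearMap ∘ₗ V.starProjection.toLinearMap)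
      = ∑ i, (‖complProj E (EuclideanSpace.basisFun (Fin p) ℝ i)‖ ^ 2
          - ‖complProj E (EuclideanSpace.basisFun (Fin p) ℝ i)
              - V.starProjection (complProj E (EuclideanSpace.basisFun (Fin p) ℝ i))‖ ^ 2) := by
  have h : (complProj E).toLinearMap ∘ₗ V.starProjection.toLinearMap
      = (complProj E).toLinearMap ∘ₗ ((complProj E).toLinearMap ∘ₗ V.starProjection.toLinearMap) := by
    ext1 x
    simp [complProj_complProj]
  rw [h, LinearMap.trace_comp_comm', LinearMap.trace_eq_sum_inner _ (EuclideanSpace.basisFun _ ℝ)]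
  refine Finset.sum_congr rfl fun i _ => ?_
  simp only [LinearMap.comp_apply, ContinuousLinearMap.coe_coe]
  rw [← inner_complProj_comm]
  set y := complProj E (EuclideanSpace.basisFun (Fin p) ℝ i)
  have h1 : inner ℝ (V.starProjection y) (V.starProjection y) = inner ℝ y (V.starProjection y) := by
    rw [Submodule.inner_starProjection_left_eq_right, Submodule.starProjection_eq_self_iff.2
      (V.starProjection_apply_mem y)]
  rw [norm_sub_sq_real, ← real_inner_self_eq_norm_sq (V.starProjection y), h1]
  ring

/-- The projection jumps where the rank of `v` drops, but the distance to the span is an infimum of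
continuous functions of `v`, hence upper semicontinuous. -/
lemma measurable_norm_sub_starProjection_span {ι F : Type*} [Fintype ι]
    [NormedAddCommGroup F] [InnerProductSpace ℝ F] [FiniteDimensional ℝ F]
    [MeasurableSpace F] [BorelSpace F] (x : F) :
    Measurable fun v : ι → F => ‖x - (Submodule.span ℝ (Set.range v)).starProjection x‖ := by
  refine measurable_of_Iio fun r => IsOpen.measurableSet ?_
  have : (fun v : ι → F => ‖x - (Submodule.span ℝ (Set.range v)).starProjection x‖) ⁻¹' Set.Iio r
      = ⋃ c : ι → ℝ, {v | ‖x - ∑ k, c k • v k‖ < r} := by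
    ext v
    simp only [Set.mem_preimage, Set.mem_Iio, Set.mem_iUnion, Set.mem_ofPred_eq]
    constructor
    · intro h
      obtain ⟨c, hc⟩ := (Submodule.mem_span_range_iff_exists_fun ℝ).1
        (Submodule.starProjection_apply_mem (Submodule.span ℝ (Set.range v)) x)
      exact ⟨c, by rwa [hc]⟩
    · rintro ⟨c, hc⟩
      refine lt_of_le_of_lt ?_ hc
      rw [Submodule.starProjection_minimal]
      refine ciInf_le_of_le ⟨0, by rintro _ ⟨_, rfl⟩; exact norm_nonneg _⟩
        (⟨∑ k, c k • v k, Submodule.sum_mem _ fun k _ =>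
          Submodule.smul_mem _ _ (Submodule.subset_span (Set.mem_range_self k))⟩ :
          Submodule.span ℝ (Set.range v)) le_rfl
  rw [this]
  exact isOpen_iUnion fun c => isOpen_lt (by fun_prop) continuous_const

lemma measurable_trace_complProj_comp_starProjection {d : ℕ}
    (E : Submodule ℝ (EuclideanSpace ℝ (Fin p))) :
    Measurable fun v : Fin d → EuclideanSpace ℝ (Fin p) =>
      LinearMap.trace ℝ (EuclideanSpace ℝ (Fin p)) ((complProj E).toLinearMap ∘ₗ
        ((Submodule.span ℝ (Set.range v)).starProjection).toLinearMap) := by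
  simp_rw [trace_complProj_comp_starProjection_eq_sum]
  exact Finset.measurable_sum _ fun i _ =>
    measurable_const.sub ((measurable_norm_sub_starProjection_span _).pow_const 2)

end Projection

/-! ### Multivariate central limit theorem. -/

section CentralLimit

variable {Ω ι : Type*} [MeasurableSpace Ω] {μ : Measure Ω} [Fintype ι]

/-- The matrix `E[U Uᵀ]` of second moments. -/
noncomputable def secondMoment (μ : Measure Ω) (U : Ω → EuclideanSpace ℝ ι) : Matrix ι ι ℝ :=
  Matrix.of fun i j => ∫ ω, U ω i * U ω j ∂μ

lemma memLp_coord {U : Ω → EuclideanSpace ℝ ι} (hU : MemLp U 2 μ) (i : ι) :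
    MemLp (fun ω => U ω i) 2 μ :=
  (EuclideanSpace.proj (𝕜 := ℝ) i).comp_memLp' hU

lemma integrable_coord_mul {U : Ω → EuclideanSpace ℝ ι} (hU : MemLp U 2 μ) (i j : ι) :
    Integrable (fun ω => U ω i * U ω j) μ :=
  (memLp_coord hU i).integrable_mul (memLp_coord hU j)

lemma dotProduct_secondMoment_mulVec {U : Ω → EuclideanSpace ℝ ι} (hU : MemLp U 2 μ)
    (x : ι → ℝ) :
    x ⬝ᵥ secondMoment μ U *ᵥ x = ∫ ω, (∑ i, U ω i * x i) ^ 2 ∂μ := by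
  have h : ∀ ω, (∑ i, U ω i * x i) ^ 2 = ∑ i, ∑ j, x i * x j * (U ω i * U ω j) := fun ω => by
    rw [sq, Finset.sum_mul_sum]
    exact Finset.sum_congr rfl fun i _ => Finset.sum_congr rfl fun j _ => by ring
  simp_rw [h]
  rw [integral_finsetSum _ fun i _ => integrable_finsetSum _ fun j _ =>
    (integrable_coord_mul hU i j).const_mul _]
  refine Finset.sum_congr rfl fun i _ => ?_
  rw [integral_finsetSum _ fun j _ => (integrable_coord_mul hU i j).const_mul _, mulVec,
    dotProduct, Finset.mul_sum]
  refine Finset.sum_congr rfl fun j _ => ?_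
  rw [integral_const_mul, secondMoment, of_apply]
  ring

lemma posSemidef_secondMoment {U : Ω → EuclideanSpace ℝ ι} (hU : MemLp U 2 μ) :
    (secondMoment μ U).PosSemidef := by
  refine PosSemidef.of_dotProduct_mulVec_nonneg ?_ fun x => ?_
  · ext i j
    simp [secondMoment, mul_comm]
  · rw [star_trivial, dotProduct_secondMoment_mulVec hU]
    exact integral_nonneg fun _ => sq_nonneg _

variable [IsProbabilityMeasure μ] [DecidableEq ι]

/-- The central limit theorem for centered square-integrable random vectors. -/
theorem tendstoInDistribution_inv_sqrt_smul_sum {U : ℕ → Ω → EuclideanSpace ℝ ι}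
    (hU : MemLp (U 0) 2 μ) (h0 : ∫ ω, U 0 ω ∂μ = 0) (hindep : iIndepFun U μ)
    (hident : ∀ i, IdentDistrib (U i) (U 0) μ μ) :
    TendstoInDistribution (fun (n : ℕ) ω => (√n)⁻¹ • ∑ i ∈ Finset.range n, U i ω) atTop id
      (fun _ => μ) (multivariateGaussian 0 (secondMoment μ (U 0))) where
  forall_aemeasurable n :=
    (Finset.aemeasurable_fun_sum _ fun i _ => (hident i).aemeasurable_fst).fun_const_smul _
  tendsto := by
    -- Cramér–Wold: the characteristic function at `t` is that of the scalar sums of `⟪U i, t⟫` at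
    -- `1`.
    refine ProbabilityMeasure.tendsto_iff_tendsto_charFun.2 fun t => ?_
    have hmeas : Measurable fun u : EuclideanSpace ℝ ι => inner ℝ u t := by fun_prop
    have hVp : MemLp (fun ω => inner ℝ (U 0 ω) t) 2 μ := by
      simpa [real_inner_comm, Function.comp_def] using (innerSL ℝ t).comp_memLp' hU
    have hmean : ∫ ω, inner ℝ (U 0 ω) t ∂μ = 0 := by
      simp_rw [real_inner_comm t]
      rw [integral_inner (hU.integrable (by norm_num)), h0, inner_zero_right]
    have hvar : Var[fun ω => inner ℝ (U 0 ω) t; μ]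
        = t.ofLp ⬝ᵥ secondMoment μ (U 0) *ᵥ t.ofLp := by
      rw [variance_of_integral_eq_zero hVp.aestronglyMeasurable.aemeasurable hmean,
        dotProduct_secondMoment_mulVec hU]
      simp [PiLp.inner_apply, mul_comm]
    have hclt := tendstoInDistribution_inv_sqrt_mul_sum_sub (P := μ)
      (P' := gaussianReal 0 Var[fun ω => inner ℝ (U 0 ω) t; μ].toNNReal)
      (X := fun i ω => inner ℝ (U i ω) t) (Y := id) HasLaw.id hVp
      (hindep.comp (fun _ u => inner ℝ u t) fun _ => hmeas)
      (fun i => (hident i).comp hmeas)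
    have h1 := ProbabilityMeasure.tendsto_iff_tendsto_charFun.1 hclt.tendsto 1
    have hUm : ∀ i, AEMeasurable (U i) μ := fun i => (hident i).aemeasurable_fst
    have hsum : ∀ n : ℕ, AEMeasurable (fun ω => (√n)⁻¹ • ∑ i ∈ Finset.range n, U i ω) μ :=
      fun n => (Finset.aemeasurable_fun_sum _ fun i _ => hUm i).fun_const_smul _
    convert h1 using 1
    · ext n
      simp only [ProbabilityMeasure.coe_mk, charFun_apply]
      rw [integral_map (hsum n) (by fun_prop),
        integral_map (hclt.forall_aemeasurable n) (by fun_prop)]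
      simp only [hmean, inner_smul_left, sum_inner]
      simp
    · simp only [ProbabilityMeasure.coe_mk, Measure.map_id]
      rw [charFun_multivariateGaussian (posSemidef_secondMoment hU), charFun_gaussianReal, hvar,
        Real.coe_toNNReal _ (by
          simpa using (posSemidef_secondMoment hU).dotProduct_mulVec_nonneg t.ofLp)]
      simp

end CentralLimit

/-! ### Convergence in law of the trace statistic and mean of the limit. -/

section DeltaMethod

variable {p d : ℕ}

/-- The vector of the coordinates of `Q v_1, …, Q v_d`. -/
noncomputable def complCols (E : Submodule ℝ (EuclideanSpace ℝ (Fin p))) :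
    (Fin d → EuclideanSpace ℝ (Fin p)) →L[ℝ] EuclideanSpace ℝ (Fin p × Fin d) :=
  LinearMap.toContinuousLinearMap
    { toFun := fun v => WithLp.toLp 2 fun q => complProj E (v q.2) q.1
      map_add' := fun v w => by ext q; simp
      map_smul' := fun c v => by ext q; simp }

lemma complCols_apply (E : Submodule ℝ (EuclideanSpace ℝ (Fin p)))
    (v : Fin d → EuclideanSpace ℝ (Fin p)) (a : Fin p) (k : Fin d) :
    complCols E v (a, k) = complProj E (v k) a := rfl

lemma quadSum_complCols (E : Submodule ℝ (EuclideanSpace ℝ (Fin p)))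
    (v : Fin d → EuclideanSpace ℝ (Fin p)) (m : Fin d → Fin d → ℝ) :
    quadSum (complCols E v) m
      = ∑ k, ∑ l, m k l * inner ℝ (complProj E (v k)) (complProj E (v l)) := by
  simp [quadSum, complCols_apply, PiLp.inner_apply, mul_comm]

lemma quadSum_smul (c : ℝ) (x : EuclideanSpace ℝ (Fin p × Fin d)) (m : Fin d → Fin d → ℝ) :
    quadSum (c • x) m = c ^ 2 * quadSum x m := by
  simp only [quadSum, PiLp.smul_apply, smul_eq_mul, Finset.mul_sum]
  refine Finset.sum_congr rfl fun k _ => Finset.sum_congr rfl fun l _ =>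
    Finset.sum_congr rfl fun a _ => by ring

lemma continuous_quadSum :
    Continuous fun q : EuclideanSpace ℝ (Fin p × Fin d) × (Fin d → Fin d → ℝ) =>
      quadSum q.1 q.2 := by
  unfold quadSum
  fun_prop

lemma measurable_quadSum (m : Fin d → Fin d → ℝ) :
    Measurable fun x : EuclideanSpace ℝ (Fin p × Fin d) => quadSum x m :=
  (continuous_quadSum.comp (by fun_prop : Continuous fun x => (x, m))).measurable

lemma continuous_gram {F : Type*} [NormedAddCommGroup F] [InnerProductSpace ℝ F] :
    Continuous fun v : Fin d → F => gram ℝ v :=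
  continuous_matrix fun k l => by simp only [gram_apply]; fun_prop

/-- Cramer's rule gives measurability everywhere and continuity where the determinant is nonzero.
For a singular Gram matrix both sides are the default value `0`. -/
lemma gram_inv_apply {F : Type*} [NormedAddCommGroup F] [InnerProductSpace ℝ F]
    (v : Fin d → F) (k l : Fin d) :
    (gram ℝ v)⁻¹ k l = (gram ℝ v).det⁻¹ * (gram ℝ v).adjugate k l := by
  rw [inv_def, Ring.inverse_eq_inv', Matrix.smul_apply, smul_eq_mul]

lemma measurable_gram_inv {F : Type*} [NormedAddCommGroup F] [InnerProductSpace ℝ F]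
    [FiniteDimensional ℝ F] [MeasurableSpace F] [BorelSpace F] :
    Measurable fun (v : Fin d → F) k l => (gram ℝ v)⁻¹ k l := by
  refine measurable_pi_lambda _ fun k => measurable_pi_lambda _ fun l => ?_
  simp_rw [gram_inv_apply]
  exact (continuous_gram.matrix_det.measurable.inv).mul
    ((continuous_gram.matrix_adjugate.matrix_elem k l).measurable)

lemma continuousAt_gram_inv {F : Type*} [NormedAddCommGroup F] [InnerProductSpace ℝ F]
    {v : Fin d → F} (hv : LinearIndependent ℝ v) :
    ContinuousAt (fun (w : Fin d → F) k l => (gram ℝ w)⁻¹ k l) v := by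
  refine continuousAt_pi.2 fun k => continuousAt_pi.2 fun l => ?_
  simp_rw [gram_inv_apply]
  exact (continuous_gram.matrix_det.continuousAt.inv₀
    (det_gram_ne_zero_iff_linearIndependent.2 hv)).mul
    ((continuous_gram.matrix_adjugate.matrix_elem k l).continuousAt)

variable {Ω : Type*} [MeasurableSpace Ω] {μ : Measure Ω}

/-- The limit law of `n tr(Q P̂_n)`: the law of `∑ k l, m k l ⟪N_k, N_l⟫`, where `(N_1, …, N_d)` is a
centered Gaussian vector with the covariance of `(Q T_1, …, Q T_d)`. -/
noncomputable def limitLaw (μ : Measure Ω) (E : Submodule ℝ (EuclideanSpace ℝ (Fin p)))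
    (T : Ω → Fin d → EuclideanSpace ℝ (Fin p)) (m : Fin d → Fin d → ℝ) : Measure ℝ :=
  (multivariateGaussian 0 (secondMoment μ fun ω => complCols E (T ω))).map fun x => quadSum x m

instance (μ : Measure Ω) (E : Submodule ℝ (EuclideanSpace ℝ (Fin p)))
    (T : Ω → Fin d → EuclideanSpace ℝ (Fin p)) (m : Fin d → Fin d → ℝ) :
    IsProbabilityMeasure (limitLaw μ E T m) :=
  Measure.isProbabilityMeasure_map
    (measurable_quadSum m).aemeasurable

/-- For an i.i.d. sample of families of `d` vectors whose means are linearly independent elements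
of `E`, the statistic `n tr(Q P̂_n)` of the span of the empirical means converges in law. -/
theorem tendstoInDistribution_trace [IsProbabilityMeasure μ]
    (E : Submodule ℝ (EuclideanSpace ℝ (Fin p)))
    {T : ℕ → Ω → Fin d → EuclideanSpace ℝ (Fin p)} (hT : MemLp (T 0) 2 μ)
    (hli : LinearIndependent ℝ (∫ ω, T 0 ω ∂μ)) (hE : ∀ k, (∫ ω, T 0 ω ∂μ) k ∈ E)
    (hindep : iIndepFun T μ) (hident : ∀ i, IdentDistrib (T i) (T 0) μ μ) :
    TendstoInDistribution (fun (n : ℕ) ω => n * LinearMap.trace ℝ (EuclideanSpace ℝ (Fin p))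
        ((complProj E).toLinearMap ∘ₗ ((Submodule.span ℝ (Set.range
          ((n : ℝ)⁻¹ • ∑ i ∈ Finset.range n, T i ω))).starProjection).toLinearMap))
      atTop id (fun _ => μ)
      (limitLaw μ E (T 0) fun k l => (gram ℝ (∫ ω, T 0 ω ∂μ))⁻¹ k l) := by
  set θ := ∫ ω, T 0 ω ∂μ
  have hTm : ∀ i, AEMeasurable (T i) μ := fun i => (hident i).aemeasurable_fst
  have hTi : Integrable (T 0) μ := hT.integrable (by norm_num)
  have havg : ∀ n : ℕ, AEMeasurable (fun ω => (n : ℝ)⁻¹ • ∑ i ∈ Finset.range n, T i ω) μ :=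
    fun n => (Finset.aemeasurable_fun_sum _ fun i _ => hTm i).fun_const_smul _
  have hlln := strong_law_ae T hTi (fun i j hij => hindep.indepFun hij) hident
  -- The means lie in `E`, so the images under `Q` are centered.
  have hclt := tendstoInDistribution_inv_sqrt_smul_sum (U := fun i ω => complCols E (T i ω))
    ((complCols E).comp_memLp' hT)
    (by
      rw [ContinuousLinearMap.integral_comp_comm _ hTi]
      ext ⟨a, k⟩
      rw [complCols_apply, (complProj_eq_zero_iff E).2 (hE k), PiLp.zero_apply, PiLp.zero_apply])
    (hindep.comp _ fun _ => (complCols E).continuous.measurable)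
    (fun i => (hident i).comp (complCols E).continuous.measurable)
  have hinv : TendstoInMeasure μ (fun (n : ℕ) ω k l =>
      (gram ℝ ((n : ℝ)⁻¹ • ∑ i ∈ Finset.range n, T i ω))⁻¹ k l) atTop
      (fun _ k l => (gram ℝ θ)⁻¹ k l) := by
    refine tendstoInMeasure_of_tendsto_ae
      (fun n => (measurable_gram_inv.comp_aemeasurable (havg n)).aestronglyMeasurable) ?_
    filter_upwards [hlln] with ω hω
    exact (continuousAt_gram_inv hli).tendsto.comp hω
  -- Slutsky, with the Gaussian fluctuations in one coordinate and the inverse Gram matrix, which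
  -- has a constant limit, in the other.
  have hslutsky := hclt.continuous_comp_prodMk_of_tendstoInMeasure_const continuous_quadSum hinv
    fun n => measurable_gram_inv.comp_aemeasurable (havg n)
  have hlim : TendstoInDistribution (fun (n : ℕ) ω =>
      quadSum ((√n)⁻¹ • ∑ i ∈ Finset.range n, complCols E (T i ω))
        (fun k l => (gram ℝ ((n : ℝ)⁻¹ • ∑ i ∈ Finset.range n, T i ω))⁻¹ k l))
      atTop id (fun _ => μ) (limitLaw μ E (T 0) fun k l => (gram ℝ θ)⁻¹ k l) := by
    refine ⟨hslutsky.forall_aemeasurable, aemeasurable_id, ?_⟩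
    convert hslutsky.tendsto using 2
    congr 1
    exact Subtype.ext (by simp only [Measure.map_id]; rfl)
  have hmeas : ∀ n : ℕ, AEMeasurable (fun ω => (n : ℝ) * LinearMap.trace ℝ
      (EuclideanSpace ℝ (Fin p)) ((complProj E).toLinearMap ∘ₗ ((Submodule.span ℝ (Set.range
        ((n : ℝ)⁻¹ • ∑ i ∈ Finset.range n, T i ω))).starProjection).toLinearMap)) μ :=
    fun n => ((measurable_trace_complProj_comp_starProjection E).comp_aemeasurable
      (havg n)).const_mul _
  -- The statistic equals the quadratic form once the empirical means are independent. Almost surely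
  -- this holds for all large `n`, the Gram determinant having a nonzero limit, so the difference is
  -- eventually `0`.
  refine tendstoInDistribution_of_tendstoInMeasure_sub _ _ hlim ?_ hmeas
  refine tendstoInMeasure_of_tendsto_ae
    (fun n => ((hmeas n).sub (hlim.forall_aemeasurable n)).aestronglyMeasurable) ?_
  filter_upwards [hlln] with ω hω
  refine tendsto_const_nhds.congr' ?_
  have hev := hω.eventually (continuous_gram.matrix_det.continuousAt.eventually_ne
    (det_gram_ne_zero_iff_linearIndependent.2 hli))
  filter_upwards [hev, eventually_gt_atTop 0] with n hn hn0
  have hn' : (0 : ℝ) < n := by exact_mod_cast hn0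
  have hcols : (√(n : ℝ))⁻¹ • ∑ i ∈ Finset.range n, complCols E (T i ω)
      = √(n : ℝ) • complCols E ((n : ℝ)⁻¹ • ∑ i ∈ Finset.range n, T i ω) := by
    rw [map_smul, map_sum, smul_smul]
    congr 1
    rw [inv_eq_iff_eq_inv, mul_inv, inv_inv, ← div_eq_inv_mul, Real.div_sqrt]
  rw [Pi.zero_apply, Pi.sub_apply, Pi.sub_apply, hcols, quadSum_smul, Real.sq_sqrt hn'.le,
    trace_complProj_comp_starProjection E (det_gram_ne_zero_iff_linearIndependent.1 hn),
    quadSum_complCols, sub_self]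

lemma integrable_coord_mul_multivariateGaussian {ι : Type*} [Fintype ι] [DecidableEq ι]
    (S : Matrix ι ι ℝ) (i j : ι) :
    Integrable (fun x : EuclideanSpace ℝ ι => x i * x j) (multivariateGaussian 0 S) :=
  integrable_coord_mul (U := id) IsGaussian.memLp_two_id i j

lemma integral_coord_mul_multivariateGaussian {ι : Type*} [Fintype ι] [DecidableEq ι]
    {S : Matrix ι ι ℝ} (hS : S.PosSemidef) (i j : ι) :
    ∫ x : EuclideanSpace ℝ ι, x i * x j ∂(multivariateGaussian 0 S) = S i j := by
  have hmem : MemLp (id : EuclideanSpace ℝ ι → _) 2 (multivariateGaussian 0 S) :=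
    IsGaussian.memLp_two_id
  have hmean : ∀ k : ι, ∫ x : EuclideanSpace ℝ ι, x k ∂(multivariateGaussian 0 S) = 0 := fun k => by
    have := (EuclideanSpace.proj (𝕜 := ℝ) k).integral_comp_comm
      (IsGaussian.integrable_id (μ := multivariateGaussian (0 : EuclideanSpace ℝ ι) S))
    simpa using this
  rw [← covariance_eval_multivariateGaussian (μ := 0) hS i j,
    covariance_eq_sub (by simpa using memLp_coord hmem i) (by simpa using memLp_coord hmem j)]
  simp [hmean]

lemma quadSum_eq_sum (m : Fin d → Fin d → ℝ) : (fun x : EuclideanSpace ℝ (Fin p × Fin d) =>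
    quadSum x m) = fun x => ∑ k, ∑ l, ∑ a, m k l * (x (a, k) * x (a, l)) := by
  ext x
  simp only [quadSum, Finset.mul_sum]

lemma integrable_id_limitLaw (μ : Measure Ω) (E : Submodule ℝ (EuclideanSpace ℝ (Fin p)))
    (T : Ω → Fin d → EuclideanSpace ℝ (Fin p)) (m : Fin d → Fin d → ℝ) :
    Integrable (id : ℝ → ℝ) (limitLaw μ E T m) := by
  rw [limitLaw, integrable_map_measure aestronglyMeasurable_id
    (measurable_quadSum m).aemeasurable,
    Function.id_comp, quadSum_eq_sum]
  exact integrable_finsetSum _ fun k _ => integrable_finsetSum _ fun l _ =>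
    integrable_finsetSum _ fun a _ => (integrable_coord_mul_multivariateGaussian _ _ _).const_mul _

/-- The mean of a quadratic form depends only on second moments, and the Gaussian vector has those
of `complCols E (T ω)`. -/
lemma integral_limitLaw (E : Submodule ℝ (EuclideanSpace ℝ (Fin p)))
    {T : Ω → Fin d → EuclideanSpace ℝ (Fin p)} (hT : MemLp T 2 μ) (m : Fin d → Fin d → ℝ) :
    ∫ x, x ∂(limitLaw μ E T m)
      = ∑ k, ∑ l, m k l * ∫ ω, inner ℝ (complProj E (T ω k)) (complProj E (T ω l)) ∂μ := by
  have hU : MemLp (fun ω => complCols E (T ω)) 2 μ := (complCols E).comp_memLp' hT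
  rw [limitLaw, integral_map
    (measurable_quadSum m).aemeasurable
    (by fun_prop), quadSum_eq_sum]
  have hi := fun (k l : Fin d) (a : Fin p) => (integrable_coord_mul_multivariateGaussian
    (secondMoment μ fun ω => complCols E (T ω)) (a, k) (a, l)).const_mul (m k l)
  rw [integral_finsetSum _ fun k _ => integrable_finsetSum _ fun l _ =>
    integrable_finsetSum _ fun a _ => hi k l a]
  refine Finset.sum_congr rfl fun k _ => ?_
  rw [integral_finsetSum _ fun l _ => integrable_finsetSum _ fun a _ => hi k l a]
  refine Finset.sum_congr rfl fun l _ => ?_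
  rw [integral_finsetSum _ fun a _ => hi k l a]
  simp_rw [integral_const_mul, integral_coord_mul_multivariateGaussian (posSemidef_secondMoment hU),
    ← Finset.mul_sum, secondMoment, of_apply]
  rw [← integral_finsetSum _ fun a _ => integrable_coord_mul hU (a, k) (a, l)]
  simp [complCols_apply, PiLp.inner_apply, mul_comm]

end DeltaMethod

/-! ### Slice means lie in the standardized central subspace. -/

section Population

variable {Ω : Type*} [MeasurableSpace Ω] {μ : Measure Ω} {p : ℕ}

lemma inner_toEuclideanLin_comm {S : Matrix (Fin p) (Fin p) ℝ} (hS : S.IsHermitian)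
    (x y : EuclideanSpace ℝ (Fin p)) :
    inner ℝ (toEuclideanLin S x) y = inner ℝ x (toEuclideanLin S y) :=
  isSymmetric_toEuclideanLin_iff.2 hS x y

lemma isUnit_det_sqrt {S : Matrix (Fin p) (Fin p) ℝ} (hS : S.PosDef) :
    IsUnit (CFC.sqrt S).det := by
  have h : (CFC.sqrt S).det * (CFC.sqrt S).det = S.det := by
    rw [← det_mul, CFC.sqrt_mul_sqrt_self S hS.posSemidef.nonneg]
  refine isUnit_iff_ne_zero.2 fun h0 => hS.det_pos.ne' ?_
  rw [← h, h0, zero_mul]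

lemma continuous_standardize (μ : Measure Ω) (X : Ω → EuclideanSpace ℝ (Fin p)) :
    Continuous (standardize μ X) := by
  unfold standardize
  exact (LinearMap.continuous_of_finiteDimensional _).comp (continuous_id.sub continuous_const)

lemma memLp_standardize [IsFiniteMeasure μ] {X : Ω → EuclideanSpace ℝ (Fin p)}
    (hX : MemLp X 2 μ) : MemLp (fun ω => standardize μ X (X ω)) 2 μ :=
  (LinearMap.toContinuousLinearMap (toEuclideanLin (CFC.sqrt (covMat μ X))⁻¹)).comp_memLp'
    (hX.sub (memLp_const _))

lemma toEuclideanLin_sqrt_standardize {X : Ω → EuclideanSpace ℝ (Fin p)}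
    (hcov : (covMat μ X).PosDef) (x : EuclideanSpace ℝ (Fin p)) :
    toEuclideanLin (CFC.sqrt (covMat μ X)) (standardize μ X x) = x - ∫ ω, X ω ∂μ := by
  unfold standardize
  simp only [toLpLin_apply]
  rw [WithLp.ofLp_toLp, mulVec_mulVec, mul_nonsing_inv _ (isUnit_det_sqrt hcov), one_mulVec]

/-- If `E = L F` for a symmetric `L`, then `P_F L x` depends on `P_E x` only. -/
lemma starProjection_apply_starProjection_map
    {L : EuclideanSpace ℝ (Fin p) →ₗ[ℝ] EuclideanSpace ℝ (Fin p)}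
    (hL : ∀ x y, inner ℝ (L x) y = inner ℝ x (L y))
    (F : Submodule ℝ (EuclideanSpace ℝ (Fin p))) (x : EuclideanSpace ℝ (Fin p)) :
    F.starProjection (L ((F.map L).starProjection x)) = F.starProjection (L x) := by
  rw [← sub_eq_zero, ← map_sub, ← map_sub, Submodule.starProjection_apply_eq_zero_iff]
  intro f hf
  rw [← hL, ← neg_sub, inner_neg_right, neg_eq_zero]
  exact (F.map L).sub_starProjection_mem_orthogonal x _ (Submodule.mem_map_of_mem hf)

/-- As `X = Σ^{1/2} Z + E[X]`, `P_F X` is an affine function of `P_E Z`. This links sufficiency,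
stated for `X` and `F`, to linearity, stated for `Z` and `E`. -/
lemma comap_starProjection_le {X : Ω → EuclideanSpace ℝ (Fin p)}
    (hcov : (covMat μ X).PosDef) (F : Submodule ℝ (EuclideanSpace ℝ (Fin p))) :
    MeasurableSpace.comap (fun ω => F.starProjection (X ω)) inferInstance ≤
      MeasurableSpace.comap (fun ω => (F.map (toEuclideanLin (CFC.sqrt (covMat μ X)))).starProjection
        (standardize μ X (X ω))) inferInstance := by
  set L := toEuclideanLin (CFC.sqrt (covMat μ X))
  have hL : ∀ x y, inner ℝ (L x) y = inner ℝ x (L y) :=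
    inner_toEuclideanLin_comm (CFC.sqrt_nonneg (covMat μ X)).posSemidef.isHermitian
  have h : (fun ω => F.starProjection (X ω)) = (fun z => F.starProjection (L z + ∫ ω, X ω ∂μ)) ∘
      fun ω => (F.map L).starProjection (standardize μ X (X ω)) := by
    ext1 ω
    rw [Function.comp_apply, map_add, starProjection_apply_starProjection_map hL, ← map_add,
      toEuclideanLin_sqrt_standardize hcov, sub_add_cancel]
  have hm : Measurable fun z => F.starProjection (L z + ∫ ω, X ω ∂μ) :=
    (F.starProjection.continuous.comp
      ((LinearMap.continuous_of_finiteDimensional L).add continuous_const)).measurable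
  rw [h, ← MeasurableSpace.comap_comp]
  exact MeasurableSpace.comap_mono hm.comap_le

/-- If `E[f | 𝒳] = E[f | ℱ]`, where `ℱ ⊆ ℰ`, then `f` is orthogonal to the `𝒳`-measurable functions
whose conditional expectation given `ℰ` vanishes. -/
lemma integral_mul_eq_zero_of_condExp {Ω : Type*} {mX mF mE mΩ : MeasurableSpace Ω}
    {μ : Measure Ω} [IsProbabilityMeasure μ] (hmX : mX ≤ mΩ) (hmE : mE ≤ mΩ) (hle : mF ≤ mE)
    {f w : Ω → ℝ} (hfm : Measurable f) (hfb : ∀ ω, |f ω| ≤ 1) (hwi : Integrable w μ)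
    (hwX : StronglyMeasurable[mX] w) (hf : μ[f | mX] =ᵐ[μ] μ[f | mF]) (hw : μ[w | mE] =ᵐ[μ] 0) :
    ∫ ω, f ω * w ω ∂μ = 0 := by
  have hfi : Integrable f μ := Integrable.of_bound hfm.aestronglyMeasurable 1 (ae_of_all _ hfb)
  have hgb : ∀ᵐ ω ∂μ, ‖μ[f | mF] ω‖ ≤ 1 :=
    ae_bdd_abs_condExp_of_ae_bdd_abs (ae_of_all μ hfb)
  have hgm : StronglyMeasurable[mE] (μ[f | mF]) := stronglyMeasurable_condExp.mono hle
  have hgi : Integrable (μ[f | mF] * w) μ := hwi.bdd_mul (hgm.mono hmE).aestronglyMeasurable hgb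
  have hfw : Integrable (f * w) μ := hwi.bdd_mul hfm.aestronglyMeasurable (ae_of_all _ hfb)
  -- Condition on `mX` and pull out `w`; then the hypothesis replaces `μ[f | mX]` by `μ[f | mF]`.
  have h1 : ∫ ω, (f * w) ω ∂μ = ∫ ω, (μ[f | mF] * w) ω ∂μ := by
    rw [← integral_condExp hmX]
    refine integral_congr_ae ?_
    filter_upwards [condExp_mul_of_stronglyMeasurable_right hwX hfw hfi, hf] with ω e1 e2
    rw [e1, Pi.mul_apply, Pi.mul_apply, e2]
  -- Condition on `mE`; now the factor `μ[f | mF]` is pulled out, leaving `μ[w | mE] = 0`.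
  have h2 : ∫ ω, (μ[f | mF] * w) ω ∂μ = 0 := by
    rw [← integral_condExp hmE]
    refine integral_eq_zero_of_ae ?_
    filter_upwards [condExp_mul_of_stronglyMeasurable_left hgm hgi hwi, hw] with ω e1 e2
    rw [e1, Pi.mul_apply, e2, Pi.zero_apply, mul_zero]
  exact h1.trans h2

/-- Under the linearity condition, `E[Z 1_{Y ∈ A}]` lies in the standardized central subspace. -/
theorem integral_indicator_smul_mem [IsProbabilityMeasure μ] {X : Ω → EuclideanSpace ℝ (Fin p)}
    {Y : Ω → ℝ} (hX : Measurable X) (hY : Measurable Y) (hX2 : MemLp X 2 μ)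
    (hcov : (covMat μ X).PosDef) {E : Submodule ℝ (EuclideanSpace ℝ (Fin p))}
    (hE : IsStandardizedCentralSubspace μ X Y E)
    (hlin : LinearityCondition μ (fun ω => standardize μ X (X ω)) E)
    {A : Set ℝ} (hA : MeasurableSet A) :
    ∫ ω, A.indicator (fun _ => (1 : ℝ)) (Y ω) • standardize μ X (X ω) ∂μ ∈ E := by
  obtain ⟨F, hF, hEF⟩ := hE
  set Z := fun ω => standardize μ X (X ω) with hZ
  have hZ2 : MemLp Z 2 μ := memLp_standardize hX2
  have hZm : Measurable Z := (continuous_standardize μ X).measurable.comp hX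
  set f := (Y ⁻¹' A).indicator (fun _ => (1 : ℝ)) with hf
  have hfm : Measurable f := measurable_const.indicator (hY hA)
  have hfb : ∀ ω, |f ω| ≤ 1 := fun ω => by
    by_cases h : ω ∈ Y ⁻¹' A <;> simp [hf, h]
  have hZi : Integrable Z μ := hZ2.integrable (by norm_num)
  have hfZ : Integrable (fun ω => f ω • Z ω) μ :=
    hZi.bdd_smul 1 hfm.aestronglyMeasurable (ae_of_all _ hfb)
  change ∫ ω, f ω • Z ω ∂μ ∈ E
  -- Membership is tested against each `q` orthogonal to `E`, with `w = ⟪q, Z⟫`.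
  rw [← Submodule.orthogonal_orthogonal E]
  intro q hq
  rw [← integral_inner hfZ]
  simp_rw [inner_smul_right]
  refine integral_mul_eq_zero_of_condExp (w := fun ω => inner ℝ q (Z ω)) hX.comap_le
    (E.starProjection.continuous.measurable.comp hZm).comap_le
    (hEF ▸ comap_starProjection_le hcov F) hfm hfb (hZi.const_inner q) ?_ (hF.1 A hA) ?_
  · have h1 : Measurable fun x => inner ℝ q (standardize μ X x) :=
      (continuous_const.inner (continuous_standardize μ X)).measurable
    exact (h1.comp (comap_measurable X)).stronglyMeasurable
  -- Linearity puts `E[Z | P_E Z]` in `E`, hence orthogonal to `q`.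
  · filter_upwards [(innerSL ℝ q).comp_condExp_comm (m := MeasurableSpace.comap
        (fun ω => E.starProjection (Z ω)) inferInstance) hZi, hlin] with ω e1 e2
    refine Eq.trans (Eq.symm e1) ?_
    exact (Submodule.mem_orthogonal' _ _).1 hq _ ((complProj_eq_zero_iff E).1 e2)

end Population

/-! ### Spectral form of a symmetric matrix of rank `d`. -/

section Diagonalization

variable {H d p : ℕ}

/-- The spectral theorem, with the eigenvectors reordered so that the nonzero eigenvalues, `d` in
number by the rank, come first. -/
lemma exists_diagonalizes {G : Matrix (Fin H) (Fin H) ℝ} (hG : G.IsHermitian) (hr : G.rank = d) :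
    ∃ P₁ P₂ D₀, Diagonalizes (d := d) G P₁ P₂ D₀ := by
  have hcard : Fintype.card {i // hG.eigenvalues i ≠ 0} = Fintype.card (Fin d) := by
    rw [← hG.rank_eq_card_non_zero_eigs, hr, Fintype.card_fin]
  have hcard' : Fintype.card {i // ¬ hG.eigenvalues i ≠ 0} = Fintype.card (Fin (H - d)) := by
    rw [Fintype.card_subtype_compl, hcard]
    simp
  let e : Fin d ⊕ Fin (H - d) ≃ Fin H :=
    ((Fintype.equivOfCardEq hcard).symm.sumCongr (Fintype.equivOfCardEq hcard').symm).trans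
      (Equiv.sumCompl fun i => hG.eigenvalues i ≠ 0)
  have he : ∀ j, hG.eigenvalues (e (Sum.inr j)) = 0 := fun j =>
    not_not.1 ((Fintype.equivOfCardEq hcard').symm j).2
  let U : Matrix (Fin H) (Fin H) ℝ := hG.eigenvectorUnitary
  have hU₁ : Uᵀ * U = 1 := (mem_orthogonalGroup_iff' _ _).1 hG.eigenvectorUnitary.2
  have hU₂ : U * Uᵀ = 1 := (mem_orthogonalGroup_iff _ _).1 hG.eigenvectorUnitary.2
  have hUG : Uᵀ * G * U = diagonal hG.eigenvalues := by
    have h := hG.conjStarAlgAut_star_eigenvectorUnitary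
    rw [Unitary.conjStarAlgAut_star_apply] at h
    exact h
  have hP : fromCols (U.submatrix id (e ∘ Sum.inl)) (U.submatrix id (e ∘ Sum.inr))
      = U.submatrix id e := by
    ext i (j | j) <;> rfl
  refine ⟨U.submatrix id (e ∘ Sum.inl), U.submatrix id (e ∘ Sum.inr),
    hG.eigenvalues ∘ e ∘ Sum.inl, ?_, ?_, ?_⟩
  · rw [hP, transpose_submatrix, ← submatrix_mul _ _ _ _ _ Function.bijective_id, hU₁,
      submatrix_one_equiv]
  · rw [hP, transpose_submatrix, submatrix_mul_equiv, hU₂, submatrix_id_id]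
  · have hsub : Uᵀ.submatrix e id * G * U.submatrix id e = (Uᵀ * G * U).submatrix e e := by
      rw [submatrix_mul _ _ e id e Function.bijective_id,
        submatrix_mul _ _ e id id Function.bijective_id, submatrix_id_id]
    rw [hP, transpose_submatrix, hsub, hUG, submatrix_diagonal_equiv, ← diagonal_zero,
      fromBlocks_diagonal]
    congr 1
    ext (j | j)
    · rfl
    · exact he j

namespace Diagonalizes

variable {G : Matrix (Fin H) (Fin H) ℝ} {P₁ : Matrix (Fin H) (Fin d) ℝ}
  {P₂ : Matrix (Fin H) (Fin (H - d)) ℝ} {D₀ : Fin d → ℝ}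

lemma blocks (h : Diagonalizes G P₁ P₂ D₀) : P₁ᵀ * P₁ = 1 ∧ P₂ᵀ * P₁ = 0 := by
  have h1 := h.1
  rw [transpose_fromCols, fromRows_mul_fromCols, ← fromBlocks_one, fromBlocks_inj] at h1
  exact ⟨h1.1, h1.2.2.1⟩

lemma mul_transpose_add (h : Diagonalizes G P₁ P₂ D₀) : P₁ * P₁ᵀ + P₂ * P₂ᵀ = 1 := by
  have h1 := h.2.1
  rwa [transpose_fromCols, fromCols_mul_fromRows] at h1

lemma eq_mul (h : Diagonalizes G P₁ P₂ D₀) : G = P₁ * diagonal D₀ * P₁ᵀ := by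
  have h1 : G = fromCols P₁ P₂ * ((fromCols P₁ P₂)ᵀ * G * fromCols P₁ P₂) * (fromCols P₁ P₂)ᵀ := by
    have e : fromCols P₁ P₂ * ((fromCols P₁ P₂)ᵀ * G * fromCols P₁ P₂) * (fromCols P₁ P₂)ᵀ
        = (fromCols P₁ P₂ * (fromCols P₁ P₂)ᵀ) * G * (fromCols P₁ P₂ * (fromCols P₁ P₂)ᵀ) := by
      simp only [Matrix.mul_assoc]
    rw [e, h.2.1, Matrix.one_mul, Matrix.mul_one]
  rw [h1, h.2.2, fromCols_mul_fromBlocks, transpose_fromCols, fromCols_mul_fromRows]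
  simp

/-- `D₀ = P₁ᵀ G P₁` is positive semidefinite, and a zero entry would push its rank below that of
`G`. -/
lemma diagonal_pos (h : Diagonalizes G P₁ P₂ D₀) (hG : G.PosSemidef) (hr : G.rank = d)
    (k : Fin d) : 0 < D₀ k := by
  have hD : P₁ᵀ * G * P₁ = diagonal D₀ := by
    rw [h.eq_mul]
    calc P₁ᵀ * (P₁ * diagonal D₀ * P₁ᵀ) * P₁ = (P₁ᵀ * P₁) * diagonal D₀ * (P₁ᵀ * P₁) := by
          simp only [Matrix.mul_assoc]
      _ = diagonal D₀ := by rw [h.blocks.1, Matrix.one_mul, Matrix.mul_one]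
  have hpsd : (diagonal D₀).PosSemidef := by
    rw [← hD]
    simpa using hG.conjTranspose_mul_mul_same P₁
  refine lt_of_le_of_ne (posSemidef_diagonal_iff.1 hpsd k) fun h0 => ?_
  have h1 : d ≤ (diagonal D₀).rank := by
    calc d = G.rank := hr.symm
      _ ≤ (P₁ * diagonal D₀).rank := by rw [h.eq_mul]; exact rank_mul_le_left _ _
      _ ≤ (diagonal D₀).rank := rank_mul_le_right _ _
  rw [rank_diagonal] at h1
  have h2 : Fintype.card {i // D₀ i ≠ 0} < Fintype.card (Fin d) :=
    Fintype.card_subtype_lt (x := k) (by simp [← h0])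
  rw [Fintype.card_fin] at h2
  omega

end Diagonalizes

end Diagonalization

/-! ### The constrained trace minimization. -/

section Optimization

variable {H d p : ℕ}

lemma diagInvSqrt_transpose {m : ℕ} (v : Fin m → ℝ) : (diagInvSqrt v)ᵀ = diagInvSqrt v :=
  diagonal_transpose _

lemma diagInvSqrt_mul_diagonal_sqrt {m : ℕ} {v : Fin m → ℝ} (hv : ∀ i, 0 < v i) :
    diagInvSqrt v * diagonal (fun i => √(v i)) = 1 := by
  rw [diagInvSqrt, diagonal_mul_diagonal, ← diagonal_one]
  congr 1
  ext i
  exact inv_mul_cancel₀ (Real.sqrt_pos.2 (hv i)).ne'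

lemma diagonal_sqrt_mul_diagInvSqrt {m : ℕ} {v : Fin m → ℝ} (hv : ∀ i, 0 < v i) :
    diagonal (fun i => √(v i)) * diagInvSqrt v = 1 :=
  mul_eq_one_comm.1 (diagInvSqrt_mul_diagonal_sqrt hv)

lemma diagonal_sqrt_mul_diagonal_sqrt {m : ℕ} {v : Fin m → ℝ} (hv : ∀ i, 0 < v i) :
    diagonal (fun i => √(v i)) * diagonal (fun i => √(v i)) = diagonal v := by
  rw [diagonal_mul_diagonal]
  congr 1
  ext i
  exact Real.mul_self_sqrt (hv i).le

lemma rank_scaled_gram {C : Matrix (Fin p) (Fin H) ℝ} {v : Fin H → ℝ} (hv : ∀ i, 0 < v i) :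
    (diagInvSqrt v * Cᵀ * C * diagInvSqrt v).rank = C.rank := by
  have h : diagInvSqrt v * Cᵀ * C * diagInvSqrt v = (C * diagInvSqrt v)ᵀ * (C * diagInvSqrt v) := by
    rw [transpose_mul, diagInvSqrt_transpose]
    simp only [Matrix.mul_assoc]
  rw [h, rank_transpose_mul_self, rank_mul_eq_left_of_isUnit_det]
  exact isUnit_det_of_right_inverse (diagInvSqrt_mul_diagonal_sqrt hv)

lemma posSemidef_scaled_gram (C : Matrix (Fin p) (Fin H) ℝ) (v : Fin H → ℝ) :
    (diagInvSqrt v * Cᵀ * C * diagInvSqrt v).PosSemidef := by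
  have h : diagInvSqrt v * Cᵀ * C * diagInvSqrt v
      = (C * diagInvSqrt v)ᴴ * (C * diagInvSqrt v) := by
    rw [conjTranspose_eq_transpose_of_trivial, transpose_mul, diagInvSqrt_transpose]
    simp only [Matrix.mul_assoc]
  rw [h]
  exact posSemidef_conjTranspose_mul_self _

variable {C : Matrix (Fin p) (Fin H) ℝ} {v : Fin H → ℝ} {P₁ : Matrix (Fin H) (Fin d) ℝ}
  {P₂ : Matrix (Fin H) (Fin (H - d)) ℝ} {D₀ : Fin d → ℝ}

/-- Since `G = P₁ D₀ P₁ᵀ`, the constraint sees `D^{1/2} α` only through its component along `P₁`. -/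
lemma gram_eq_of_diagonalizes (hv : ∀ i, 0 < v i) (hD₀ : ∀ k, 0 < D₀ k)
    (hP : Diagonalizes (diagInvSqrt v * Cᵀ * C * diagInvSqrt v) P₁ P₂ D₀)
    (α : Matrix (Fin H) (Fin d) ℝ) :
    (C * α)ᵀ * (C * α) =
      (diagonal (fun k => √(D₀ k)) * (P₁ᵀ * (diagonal (fun i => √(v i)) * α)))ᵀ *
        (diagonal (fun k => √(D₀ k)) * (P₁ᵀ * (diagonal (fun i => √(v i)) * α))) := by
  set S := diagonal fun i => √(v i) with hS
  have hα : diagInvSqrt v * (S * α) = α := by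
    rw [← Matrix.mul_assoc, diagInvSqrt_mul_diagonal_sqrt hv, Matrix.one_mul]
  calc (C * α)ᵀ * (C * α)
      = (C * (diagInvSqrt v * (S * α)))ᵀ * (C * (diagInvSqrt v * (S * α))) := by rw [hα]
    _ = (S * α)ᵀ * (diagInvSqrt v * Cᵀ * C * diagInvSqrt v) * (S * α) := by
        simp only [transpose_mul, diagInvSqrt_transpose, Matrix.mul_assoc]
    _ = _ := by
        rw [hP.eq_mul, ← diagonal_sqrt_mul_diagonal_sqrt hD₀]
        simp only [transpose_mul, diagonal_transpose, transpose_transpose, Matrix.mul_assoc]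

/-- Pythagoras for the Frobenius norm of `D^{1/2} α`, split along the columns of `P₁` and `P₂`. -/
lemma trace_eq_of_diagonalizes (hv : ∀ i, 0 < v i) {G : Matrix (Fin H) (Fin H) ℝ}
    (hP : Diagonalizes G P₁ P₂ D₀) (α : Matrix (Fin H) (Fin d) ℝ) :
    trace (αᵀ * diagonal v * α) =
      trace ((P₁ᵀ * (diagonal (fun i => √(v i)) * α))ᵀ *
          (P₁ᵀ * (diagonal (fun i => √(v i)) * α))) +
        trace ((P₂ᵀ * (diagonal (fun i => √(v i)) * α))ᵀ *
          (P₂ᵀ * (diagonal (fun i => √(v i)) * α))) := by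
  set S := diagonal fun i => √(v i) with hS
  rw [← trace_add]
  congr 1
  calc αᵀ * diagonal v * α = (S * α)ᵀ * ((P₁ * P₁ᵀ + P₂ * P₂ᵀ) * (S * α)) := by
        rw [hP.mul_transpose_add, Matrix.one_mul, ← diagonal_sqrt_mul_diagonal_sqrt hv]
        simp only [hS, transpose_mul, diagonal_transpose, Matrix.mul_assoc]
    _ = _ := by
        simp only [Matrix.add_mul, Matrix.mul_add, transpose_mul, transpose_transpose,
          Matrix.mul_assoc]

lemma trace_transpose_mul_self_diagInvSqrt_mul {O : Matrix (Fin d) (Fin d) ℝ}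
    (hO : O * Oᵀ = 1) :
    trace ((diagInvSqrt D₀ * O)ᵀ * (diagInvSqrt D₀ * O)) = trace (diagInvSqrt D₀ * diagInvSqrt D₀) := by
  rw [trace_mul_comm, transpose_mul, diagInvSqrt_transpose]
  congr 1
  calc diagInvSqrt D₀ * O * (Oᵀ * diagInvSqrt D₀) = diagInvSqrt D₀ * (O * Oᵀ) * diagInvSqrt D₀ := by
        simp only [Matrix.mul_assoc]
    _ = _ := by rw [hO, Matrix.mul_one]

/-- The minimizers of `tr(αᵀ D α)` subject to `(Cα)ᵀ(Cα) = I`. -/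
theorem isMinimizer_iff (hv : ∀ i, 0 < v i) (hD₀ : ∀ k, 0 < D₀ k)
    (hP : Diagonalizes (diagInvSqrt v * Cᵀ * C * diagInvSqrt v) P₁ P₂ D₀)
    (α : Matrix (Fin H) (Fin d) ℝ) :
    ((C * α)ᵀ * (C * α) = 1 ∧ ∀ β : Matrix (Fin H) (Fin d) ℝ, (C * β)ᵀ * (C * β) = 1 →
        trace (αᵀ * diagonal v * α) ≤ trace (βᵀ * diagonal v * β)) ↔
      ∃ O ∈ Matrix.orthogonalGroup (Fin d) ℝ, α = diagInvSqrt v * P₁ * diagInvSqrt D₀ * O := by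
  set S := diagonal fun i => √(v i) with hS
  set N := diagonal fun k => √(D₀ k)
  -- On the feasible set the `P₁` part of the objective is the constant `tr(D₀⁻¹)`; only the `P₂`
  -- part varies.
  have key : ∀ β : Matrix (Fin H) (Fin d) ℝ, (C * β)ᵀ * (C * β) = 1 →
      N * (P₁ᵀ * (S * β)) ∈ Matrix.orthogonalGroup (Fin d) ℝ ∧
      P₁ᵀ * (S * β) = diagInvSqrt D₀ * (N * (P₁ᵀ * (S * β))) ∧
      trace (βᵀ * diagonal v * β) = trace (diagInvSqrt D₀ * diagInvSqrt D₀) +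
        trace ((P₂ᵀ * (S * β))ᵀ * (P₂ᵀ * (S * β))) := by
    intro β hβ
    rw [gram_eq_of_diagonalizes hv hD₀ hP] at hβ
    have h1 : P₁ᵀ * (S * β) = diagInvSqrt D₀ * (N * (P₁ᵀ * (S * β))) := by
      rw [← Matrix.mul_assoc (diagInvSqrt D₀), diagInvSqrt_mul_diagonal_sqrt hD₀, Matrix.one_mul]
    refine ⟨(mem_orthogonalGroup_iff' _ _).2 hβ, h1, ?_⟩
    rw [trace_eq_of_diagonalizes hv hP, ← hS, h1,
      trace_transpose_mul_self_diagInvSqrt_mul (mul_eq_one_comm.1 hβ)]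
  have feas : ∀ O ∈ Matrix.orthogonalGroup (Fin d) ℝ,
      (C * (diagInvSqrt v * P₁ * diagInvSqrt D₀ * O))ᵀ *
        (C * (diagInvSqrt v * P₁ * diagInvSqrt D₀ * O)) = 1 ∧
      P₂ᵀ * (S * (diagInvSqrt v * P₁ * diagInvSqrt D₀ * O)) = 0 := by
    intro O hO
    have h1 : S * (diagInvSqrt v * P₁ * diagInvSqrt D₀ * O) = P₁ * (diagInvSqrt D₀ * O) := by
      simp only [Matrix.mul_assoc]
      rw [← Matrix.mul_assoc S, diagonal_sqrt_mul_diagInvSqrt hv, Matrix.one_mul]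
    constructor
    · rw [gram_eq_of_diagonalizes hv hD₀ hP, h1, ← Matrix.mul_assoc P₁ᵀ, hP.blocks.1,
        Matrix.one_mul, ← Matrix.mul_assoc (diagonal _) (diagInvSqrt D₀),
        diagonal_sqrt_mul_diagInvSqrt hD₀, Matrix.one_mul]
      exact (mem_orthogonalGroup_iff' _ _).1 hO
    · rw [h1, ← Matrix.mul_assoc, hP.blocks.2, Matrix.zero_mul]
  have hnonneg : ∀ M : Matrix (Fin (H - d)) (Fin d) ℝ, 0 ≤ trace (Mᵀ * M) := fun M => by
    simpa using (posSemidef_conjTranspose_mul_self M).trace_nonneg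
  constructor
  · rintro ⟨hα, hmin⟩
    obtain ⟨hO, h1, h2⟩ := key α hα
    -- Comparison with the candidate `O = 1`, whose `P₂` part is zero, forces that of `α` to vanish.
    obtain ⟨f1, f2⟩ := feas 1 (one_mem _)
    have h3 := hmin _ f1
    rw [h2, (key _ f1).2.2, f2] at h3
    have h4 : trace ((P₂ᵀ * (S * α))ᵀ * (P₂ᵀ * (S * α))) = 0 :=
      le_antisymm (by simpa using h3) (hnonneg _)
    have h5 : P₂ᵀ * (S * α) = 0 := by
      rw [← trace_conjTranspose_mul_self_eq_zero_iff, conjTranspose_eq_transpose_of_trivial, h4]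
    -- The witness is `O = D₀^{1/2} P₁ᵀ D^{1/2} α`.
    refine ⟨_, hO, ?_⟩
    calc α = diagInvSqrt v * ((P₁ * P₁ᵀ + P₂ * P₂ᵀ) * (S * α)) := by
          rw [hP.mul_transpose_add, Matrix.one_mul, ← Matrix.mul_assoc,
            diagInvSqrt_mul_diagonal_sqrt hv, Matrix.one_mul]
      _ = diagInvSqrt v * (P₁ * (P₁ᵀ * (S * α))) := by
          rw [Matrix.add_mul, Matrix.mul_assoc P₂, h5, Matrix.mul_zero, add_zero, Matrix.mul_assoc]
      _ = _ := by
          conv_lhs => rw [h1]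
          simp only [Matrix.mul_assoc]
  · rintro ⟨O, hO, rfl⟩
    obtain ⟨f1, f2⟩ := feas O hO
    refine ⟨f1, fun β hβ => ?_⟩
    rw [(key _ f1).2.2, (key β hβ).2.2, f2, Matrix.mul_zero, trace_zero]
    exact add_le_add_right (hnonneg _) _

end Optimization

/-! ### Moments of the slice test functions. -/

section SliceMoments

variable {Ω : Type*} [MeasurableSpace Ω] {μ : Measure Ω} {p H d : ℕ}

lemma measurable_testFun {I : Fin H → Set ℝ} (hI : ∀ h, MeasurableSet (I h))
    (α : Matrix (Fin H) (Fin d) ℝ) (k : Fin d) : Measurable (testFun I α k) :=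
  Finset.measurable_sum _ fun h _ => (measurable_const.indicator (hI h)).const_mul _

lemma testFun_smul (I : Fin H → Set ℝ) (α : Matrix (Fin H) (Fin d) ℝ) (k : Fin d) (y : ℝ)
    (z : EuclideanSpace ℝ (Fin p)) :
    testFun I α k y • z = ∑ h, α h k • ((I h).indicator (fun _ => (1 : ℝ)) y • z) := by
  simp only [testFun, Finset.sum_smul, mul_smul]

/-- Disjoint slices kill the cross terms; this is why the weight matrix `D` is diagonal. -/
lemma testFun_mul_testFun {I : Fin H → Set ℝ}
    (hI : Pairwise fun h h' => Disjoint (I h) (I h'))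
    (α : Matrix (Fin H) (Fin d) ℝ) (k l : Fin d) (y : ℝ) :
    testFun I α k y * testFun I α l y
      = ∑ h, α h k * α h l * (I h).indicator (fun _ => (1 : ℝ)) y := by
  rw [testFun, testFun, Finset.sum_mul_sum]
  refine Finset.sum_congr rfl fun h _ => ?_
  rw [Finset.sum_eq_single h]
  · by_cases hy : y ∈ I h <;> simp [hy]
  · intro h' _ hne
    by_cases hy : y ∈ I h
    · simp [Set.disjoint_left.1 (hI hne.symm) hy]
    · simp [hy]
  · simp

lemma memLp_indicator_smul {Z : Ω → EuclideanSpace ℝ (Fin p)} (hZ : MemLp Z 2 μ) {Y : Ω → ℝ}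
    (hY : Measurable Y) {A : Set ℝ} (hA : MeasurableSet A) :
    MemLp (fun ω => A.indicator (fun _ => (1 : ℝ)) (Y ω) • Z ω) 2 μ := by
  have h : (fun ω => A.indicator (fun _ => (1 : ℝ)) (Y ω) • Z ω) = (Y ⁻¹' A).indicator Z := by
    ext1 ω
    by_cases hω : Y ω ∈ A
    · rw [Set.indicator_of_mem hω, one_smul, Set.indicator_of_mem (show ω ∈ Y ⁻¹' A from hω)]
    · rw [Set.indicator_of_notMem hω, zero_smul,
        Set.indicator_of_notMem (show ω ∉ Y ⁻¹' A from hω)]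
  rw [h]
  exact hZ.indicator (hY hA)

/-- The vector `(ψ_1(Y) Z, …, ψ_d(Y) Z)`. -/
noncomputable def testVec (I : Fin H → Set ℝ) (α : Matrix (Fin H) (Fin d) ℝ)
    (q : EuclideanSpace ℝ (Fin p) × ℝ) : Fin d → EuclideanSpace ℝ (Fin p) :=
  fun k => testFun I α k q.2 • q.1

lemma measurable_testVec {I : Fin H → Set ℝ} (hI : ∀ h, MeasurableSet (I h))
    (α : Matrix (Fin H) (Fin d) ℝ) : Measurable (testVec (p := p) I α) :=
  measurable_pi_lambda _ fun k =>
    ((measurable_testFun hI α k).comp measurable_snd).smul measurable_fst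

variable {Z : Ω → EuclideanSpace ℝ (Fin p)} {Y : Ω → ℝ} {I : Fin H → Set ℝ}

lemma memLp_testVec (hZ : MemLp Z 2 μ) (hY : Measurable Y) (hI : ∀ h, MeasurableSet (I h))
    (α : Matrix (Fin H) (Fin d) ℝ) : MemLp (fun ω => testVec I α (Z ω, Y ω)) 2 μ := by
  refine MemLp.of_eval fun k => ?_
  simp only [testVec, testFun_smul]
  exact memLp_finsetSum _ fun h _ => (memLp_indicator_smul hZ hY (hI h)).const_smul (α h k)

lemma integral_testVec [IsFiniteMeasure μ] (hZ : MemLp Z 2 μ) (hY : Measurable Y)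
    (hI : ∀ h, MeasurableSet (I h)) (α : Matrix (Fin H) (Fin d) ℝ) :
    ∫ ω, testVec I α (Z ω, Y ω) ∂μ = eta μ Z Y I α := by
  ext1 k
  exact ((ContinuousLinearMap.proj (R := ℝ) k).integral_comp_comm
    ((memLp_testVec hZ hY hI α).integrable (by norm_num))).symm

lemma eta_eq_sum [IsFiniteMeasure μ] (hZ : MemLp Z 2 μ) (hY : Measurable Y)
    (hI : ∀ h, MeasurableSet (I h)) (α : Matrix (Fin H) (Fin d) ℝ) (k : Fin d) :
    eta μ Z Y I α k = ∑ h, α h k • sliceVec μ Z Y I h := by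
  unfold eta sliceVec
  simp_rw [testFun_smul]
  rw [integral_finsetSum _ fun h _ =>
    ((memLp_indicator_smul hZ hY (hI h)).integrable (by norm_num)).fun_smul (α h k)]
  simp_rw [integral_smul]

lemma etaMat_eq_mul [IsFiniteMeasure μ] (hZ : MemLp Z 2 μ) (hY : Measurable Y)
    (hI : ∀ h, MeasurableSet (I h)) (α : Matrix (Fin H) (Fin d) ℝ) :
    etaMat μ Z Y I α = sliceMat μ Z Y I * α := by
  ext i k
  rw [etaMat, of_apply, eta_eq_sum hZ hY hI]
  simp [sliceMat, Matrix.mul_apply, mul_comm]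

/-- The constraint thus makes the inverse Gram matrix in the limit law the identity. -/
lemma transpose_etaMat_mul_etaMat (μ : Measure Ω) (Z : Ω → EuclideanSpace ℝ (Fin p)) (Y : Ω → ℝ)
    (I : Fin H → Set ℝ) (α : Matrix (Fin H) (Fin d) ℝ) :
    (etaMat μ Z Y I α)ᵀ * etaMat μ Z Y I α = gram ℝ (eta μ Z Y I α) := by
  ext k l
  simp [Matrix.mul_apply, etaMat, gram_apply, PiLp.inner_apply, mul_comm]

lemma rank_sliceMat {E : Submodule ℝ (EuclideanSpace ℝ (Fin p))}
    (hE : Submodule.span ℝ (Set.range (sliceVec μ Z Y I)) = E) :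
    (sliceMat μ Z Y I).rank = Module.finrank ℝ E := by
  have h : Set.range (sliceMat μ Z Y I).col
      = WithLp.linearEquiv 2 ℝ (Fin p → ℝ) '' Set.range (sliceVec μ Z Y I) := by
    rw [← Set.range_comp]
    rfl
  rw [rank_eq_finrank_span_cols, h, ← hE]
  have h2 := Submodule.map_span (WithLp.linearEquiv 2 ℝ (Fin p → ℝ)).toLinearMap
    (Set.range (sliceVec μ Z Y I))
  rw [LinearEquiv.coe_coe] at h2
  rw [← h2]
  exact LinearEquiv.finrank_map_eq _ _

lemma integral_inner_complProj_testVec (E : Submodule ℝ (EuclideanSpace ℝ (Fin p)))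
    (hZ : MemLp Z 2 μ) (hY : Measurable Y) (hI : ∀ h, MeasurableSet (I h))
    (hdisj : Pairwise fun h h' => Disjoint (I h) (I h'))
    (α : Matrix (Fin H) (Fin d) ℝ) (k l : Fin d) :
    ∫ ω, inner ℝ (complProj E (testVec I α (Z ω, Y ω) k))
        (complProj E (testVec I α (Z ω, Y ω) l)) ∂μ
      = (αᵀ * diagonal (sliceVar μ E Z Y I) * α) k l := by
  have h1 : ∀ ω, inner ℝ (complProj E (testVec I α (Z ω, Y ω) k))
        (complProj E (testVec I α (Z ω, Y ω) l))
      = ∑ h, α h k * α h l *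
        (‖complProj E (Z ω)‖ ^ 2 * (I h).indicator (fun _ => (1 : ℝ)) (Y ω)) := fun ω => by
    simp only [testVec, map_smul, inner_smul_left, inner_smul_right, RCLike.conj_to_real,
      real_inner_self_eq_norm_sq]
    rw [← mul_assoc, testFun_mul_testFun hdisj, Finset.sum_mul]
    exact Finset.sum_congr rfl fun h _ => by ring
  have hQ : Integrable (fun ω => ‖complProj E (Z ω)‖ ^ 2) μ :=
    ((complProj E).comp_memLp' hZ).integrable_norm_pow (by norm_num)
  have hi : ∀ h, Integrable (fun ω => ‖complProj E (Z ω)‖ ^ 2 *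
      (I h).indicator (fun _ => (1 : ℝ)) (Y ω)) μ := fun h => by
    refine hQ.mul_bdd (c := 1)
      ((measurable_const.indicator (hI h)).comp hY).aestronglyMeasurable (ae_of_all _ fun ω => ?_)
    by_cases hω : Y ω ∈ I h <;> simp [hω]
  simp_rw [h1]
  rw [integral_finsetSum _ fun h _ => (hi h).const_mul _]
  simp_rw [integral_const_mul]
  rw [Matrix.mul_apply]
  refine Finset.sum_congr rfl fun h _ => ?_
  rw [mul_diagonal, transpose_apply, sliceVar]
  ring

/-- The limit law depends on `T` through second moments only, which lets the generic pair replace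
the first sample point. -/
lemma limitLaw_eq_of_identDistrib (E : Submodule ℝ (EuclideanSpace ℝ (Fin p)))
    {T T' : Ω → Fin d → EuclideanSpace ℝ (Fin p)} (h : IdentDistrib T T' μ μ)
    (m : Fin d → Fin d → ℝ) : limitLaw μ E T m = limitLaw μ E T' m := by
  have hS : (secondMoment μ fun ω => complCols E (T ω))
      = secondMoment μ fun ω => complCols E (T' ω) := by
    ext i j
    have hm : Measurable fun v : Fin d → EuclideanSpace ℝ (Fin p) =>
        complCols E v i * complCols E v j := by fun_prop
    exact (h.comp hm).integral_eq
  rw [limitLaw, limitLaw, hS]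

end SliceMoments

end TestFunction

/-! ### Limit law and minimizers together. -/

theorem mainTheorem8
    {Ω : Type*} [MeasurableSpace Ω] (μ : Measure Ω) [IsProbabilityMeasure μ]
    {p H d : ℕ}
    -- the generic pair `(X, Y)`
    (X : Ω → EuclideanSpace ℝ (Fin p)) (Y : Ω → ℝ)
    (hX : Measurable X) (hY : Measurable Y)
    (hX2 : MemLp X 2 μ) (hcov : (TestFunction.covMat μ X).PosDef)
    -- the standardized predictor
    (Z : Ω → EuclideanSpace ℝ (Fin p)) (hZ : Z = fun ω => TestFunction.standardize μ X (X ω))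
    -- the standardized central subspace, of dimension `d`, and the linearity condition
    (E : Submodule ℝ (EuclideanSpace ℝ (Fin p)))
    (hE : TestFunction.IsStandardizedCentralSubspace μ X Y E)
    (hd : Module.finrank ℝ E = d)
    (hlin : TestFunction.LinearityCondition μ Z E)
    -- the slices, fine enough for the vectors `C_h` to cover the whole of `E`
    (I : Fin H → Set ℝ) (hI : ∀ h, MeasurableSet (I h))
    (hIdisj : Pairwise fun h h' => Disjoint (I h) (I h'))
    (hcover : E ≤ Submodule.span ℝ (Set.range (TestFunction.sliceVec μ Z Y I)))
    (hpos : ∀ h, 0 < TestFunction.sliceVar μ E Z Y I h)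
    -- the i.i.d. sample
    (Xs : ℕ → Ω → EuclideanSpace ℝ (Fin p)) (Ys : ℕ → Ω → ℝ)
    (hindep : iIndepFun (fun i ω => (Xs i ω, Ys i ω)) μ)
    (hident : ∀ i, IdentDistrib (fun ω => (Xs i ω, Ys i ω)) (fun ω => (X ω, Y ω)) μ μ) :
    ∃ W : Matrix (Fin H) (Fin d) ℝ → ProbabilityMeasure ℝ,
      -- `n tr(Q P̂_n)` converges in law to `W α`, whose mean is finite
      (∀ α : Matrix (Fin H) (Fin d) ℝ, LinearIndependent ℝ (TestFunction.eta μ Z Y I α) →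
        TendstoInDistribution
          (fun (n : ℕ) ω => TestFunction.traceStat E
            (fun i => TestFunction.standardize μ X (Xs i ω)) (fun i => Ys i ω) I α n)
          atTop (id : ℝ → ℝ) (fun _ => μ) (W α : Measure ℝ) ∧
        Integrable (id : ℝ → ℝ) (W α : Measure ℝ)) ∧
      -- `G` has rank `d` and can be diagonalized in the required form
      (TestFunction.gramMat μ E Z Y I).rank = d ∧
      (∃ P₁ P₂ D₀, TestFunction.Diagonalizes (d := d) (TestFunction.gramMat μ E Z Y I) P₁ P₂ D₀) ∧
      -- the minimizers are the matrices `D^{-1/2} P₁ D₀^{-1/2} O` with `O` orthogonal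
      (∀ P₁ P₂ D₀, TestFunction.Diagonalizes (d := d) (TestFunction.gramMat μ E Z Y I) P₁ P₂ D₀ →
        (∀ k, 0 < D₀ k) ∧
        ∀ α : Matrix (Fin H) (Fin d) ℝ,
          TestFunction.IsOptimal μ Z Y I W α ↔
            ∃ O ∈ Matrix.orthogonalGroup (Fin d) ℝ,
              α = TestFunction.diagInvSqrt (TestFunction.sliceVar μ E Z Y I) * P₁ *
                TestFunction.diagInvSqrt D₀ * O) := by
  subst hZ
  set Z := fun ω => TestFunction.standardize μ X (X ω) with hZ
  have hZ2 : MemLp Z 2 μ := TestFunction.memLp_standardize hX2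
  have hC : ∀ h, TestFunction.sliceVec μ Z Y I h ∈ E := fun h =>
    TestFunction.integral_indicator_smul_mem hX hY hX2 hcov hE hlin (hI h)
  have hspan : Submodule.span ℝ (Set.range (TestFunction.sliceVec μ Z Y I)) = E :=
    le_antisymm (Submodule.span_le.2 (Set.range_subset_iff.2 hC)) hcover
  have hrankC : (TestFunction.sliceMat μ Z Y I).rank = d :=
    (TestFunction.rank_sliceMat hspan).trans hd
  have hrank : (TestFunction.gramMat μ E Z Y I).rank = d :=
    (TestFunction.rank_scaled_gram hpos).trans hrankC
  have hpsd : (TestFunction.gramMat μ E Z Y I).PosSemidef :=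
    TestFunction.posSemidef_scaled_gram _ _
  -- When the `η_k` are dependent the inverse is the default `0`; this is harmless, since
  -- convergence is claimed only for independent `η_k` and optimality compares only `α` with `ηᵀη =
  -- I`.
  let W : Matrix (Fin H) (Fin d) ℝ → ProbabilityMeasure ℝ := fun α =>
    ⟨TestFunction.limitLaw μ E (fun ω => TestFunction.testVec I α (Z ω, Y ω))
      (fun k l => (gram ℝ (TestFunction.eta μ Z Y I α))⁻¹ k l), inferInstance⟩
  have hmean : ∀ α : Matrix (Fin H) (Fin d) ℝ,
      (TestFunction.etaMat μ Z Y I α)ᵀ * TestFunction.etaMat μ Z Y I α = 1 →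
      ∫ x, x ∂(W α : Measure ℝ)
        = trace (αᵀ * diagonal (TestFunction.sliceVar μ E Z Y I) * α) := by
    intro α hα
    rw [TestFunction.transpose_etaMat_mul_etaMat] at hα
    change ∫ x, x ∂(TestFunction.limitLaw μ E (fun ω => TestFunction.testVec I α (Z ω, Y ω))
      (fun k l => (gram ℝ (TestFunction.eta μ Z Y I α))⁻¹ k l)) = _
    rw [TestFunction.integral_limitLaw E (TestFunction.memLp_testVec hZ2 hY hI α), hα, inv_one]
    simp_rw [TestFunction.integral_inner_complProj_testVec E hZ2 hY hI hIdisj]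
    simp [Matrix.one_apply, trace]
  refine ⟨W, fun α hα => ⟨?_, TestFunction.integrable_id_limitLaw _ _ _ _⟩, hrank,
    TestFunction.exists_diagonalizes hpsd.isHermitian hrank, fun P₁ P₂ D₀ hP => ?_⟩
  -- A single measurable map sends each sample pair to its test vectors, so independence and
  -- equality in law carry over.
  · let φ : EuclideanSpace ℝ (Fin p) × ℝ → Fin d → EuclideanSpace ℝ (Fin p) := fun q =>
      TestFunction.testVec I α (TestFunction.standardize μ X q.1, q.2)
    have hφ : Measurable φ := (TestFunction.measurable_testVec hI α).comp
      (((TestFunction.continuous_standardize μ X).measurable.comp measurable_fst).prodMk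
        measurable_snd)
    have hid : ∀ i, IdentDistrib (fun ω => φ (Xs i ω, Ys i ω)) (fun ω => φ (X ω, Y ω)) μ μ :=
      fun i => (hident i).comp hφ
    have hint : ∫ ω, φ (Xs 0 ω, Ys 0 ω) ∂μ = TestFunction.eta μ Z Y I α :=
      (hid 0).integral_eq.trans (TestFunction.integral_testVec hZ2 hY hI α)
    have hlim := TestFunction.tendstoInDistribution_trace E
      (T := fun i ω => φ (Xs i ω, Ys i ω))
      ((hid 0).memLp_iff.2 (TestFunction.memLp_testVec hZ2 hY hI α))
      (by rw [hint]; exact hα)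
      (fun k => by
        rw [hint, TestFunction.eta_eq_sum hZ2 hY hI]
        exact Submodule.sum_mem _ fun h _ => Submodule.smul_mem _ _ (hC h))
      (hindep.comp _ fun _ => hφ) (fun i => (hid i).trans (hid 0).symm)
    simp only [hint, TestFunction.limitLaw_eq_of_identDistrib E (hid 0)] at hlim
    convert hlim using 4 with n ω
    · simp only [TestFunction.traceStat, TestFunction.projHat]
      congr 6
      ext1 k
      simp [TestFunction.etaHat, φ, TestFunction.testVec]
    · rfl
  · have hD₀ := fun k => hP.diagonal_pos hpsd hrank k
    refine ⟨hD₀, fun α => ?_⟩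
    rw [← TestFunction.isMinimizer_iff hpos hD₀ hP α]
    simp_rw [← TestFunction.etaMat_eq_mul hZ2 hY hI]
    refine and_congr_right fun hα => forall₂_congr fun β hβ => ?_
    rw [hmean α hα, hmean β hβ]
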